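/- Let $n,d\ge 1$ and $N$ be integers and let $0<\varepsilon<1$ be such that $\log_2(n/\varepsilon)\ge 1$ (this is automatic for $n\ge 2$). Consider $N$ qubits on a line. A depth-$d$ 1D-QAC circuit is a product $C=L_dM_d\cdots L_1M_1L_0$, where each $L_k$ is a layer of arbitrary single-qubit unitaries and each $M_k$ is a layer of generalized CZ gates (the gate on a set $T$ of qubits multiplies a computational basis state by $-1$ if all qubits of $T$ are $1$, and fixes it otherwise) acting on pairwise disjoint nonempty intervals of consecutive qubits. Let $C$ be such a circuit, and let $I$ be an arbitrary set of $n$ of the $N$ qubits, the input qubits; the other qubits are ancillas, prepared in an arbitrary fixed pure state $|a\rangle$ (possibly entangled, and of any number). For $x\in\{0,1\}^I$ let $f_C(x)\in[0,1]$ be the probability that measuring a fixed output qubit $q$ (any of the $N$ qubits) of $C(|x\rangle\otimes|a\rangle)$ in the computational basis gives $1$. For $h:\{0,1\}^I\to\mathbb R$ write $\|h\|_2=\left(2^{-n}\sum_{x}h(x)^2\right)^{1/2}$. Then there exist a set $S\subseteq I$ and a function $f:\{0,1\}^I\to[0,1]$ such that 1. $|I\setminus S|\ge \dfrac{n}{(\log_2(n/\varepsilon))^d}$;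 2. $\|f-f_C\|_2\le 4\sqrt{2d\varepsilon}$; 3. for every $z\in\{0,1\}^S$, the restriction $f|_{S,z}:\{0,1\}^{I\setminus S}\to[0,1]$, $f|_{S,z}(y)=f(z,y)$, depends on at most one index: there are $i\in I\setminus S$ and $g:\{0,1\}\to[0,1]$ with $f|_{S,z}(y)=g(y_i)$ for all $y\in\{0,1\}^{I\setminus S}$. -/

import Mathlib

open scoped Matrix

noncomputable section

/-! Bits are Booleans, with `true` for `1`. The computational basis of the qubits in `Q` is the
set of assignments `Q → Bool`; states are amplitude vectors and operators are matrices over it. -/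

/-- The tensor product `⨂ i, U i` of one-qubit operators, one for each of the `N` qubits. -/
def tensorOperator {N : ℕ} (U : Fin N → Matrix Bool Bool ℂ) :
    Matrix (Fin N → Bool) (Fin N → Bool) ℂ :=
  Matrix.of fun y x => ∏ i, U i (y i) (x i)

/-- A layer of single-qubit unitaries on `N` qubits. -/
abbrev SingleQubitLayer (N : ℕ) : Type := Fin N → Matrix.unitaryGroup Bool ℂ

/-- The operator of a layer of single-qubit unitaries. -/
def SingleQubitLayer.operator {N : ℕ} (L : SingleQubitLayer N) :
    Matrix (Fin N → Bool) (Fin N → Bool) ℂ :=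
  tensorOperator fun i => (L i : Matrix Bool Bool ℂ)

/-- The generalized CZ gate with support `T`: it multiplies a basis state by `-1` if all qubits
in `T` are `1`, and fixes it otherwise. -/
def czGate {N : ℕ} (T : Finset (Fin N)) : Matrix (Fin N → Bool) (Fin N → Bool) ℂ :=
  Matrix.diagonal fun x => if ∀ i ∈ T, x i = true then -1 else 1

/-- CZ gates commute, so that a product over a finite set of them makes sense. -/
theorem czGate_commute {N : ℕ} (T T' : Finset (Fin N)) : Commute (czGate T) (czGate T') := by
  unfold czGate
  rw [commute_iff_eq, Matrix.diagonal_mul_diagonal, Matrix.diagonal_mul_diagonal]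
  simp only [mul_comm]

/-- A layer of CZ gates on `N` qubits placed on a line: gates with pairwise disjoint supports,
each support being a nonempty set of consecutive qubits. A layer may have no gate at all. -/
structure CZLayer (N : ℕ) where
  gates : Finset (Finset (Fin N))
  nonempty : ∀ T ∈ gates, T.Nonempty
  interval : ∀ T ∈ gates, (T : Set (Fin N)).OrdConnected
  disjoint : (gates : Set (Finset (Fin N))).PairwiseDisjoint id

/-- The operator of a layer of CZ gates. -/
def CZLayer.operator {N : ℕ} (M : CZLayer N) : Matrix (Fin N → Bool) (Fin N → Bool) ℂ :=
  M.gates.noncommProd czGate fun T _ T' _ _ => czGate_commute T T'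

/-- `OneDimQAC N d`: the depth-`d` 1D-QAC circuits `L_d M_d ⋯ L_1 M_1 L_0` on `N` qubits placed on
a line. The depth is the number of layers of CZ gates. -/
inductive OneDimQAC (N : ℕ) : ℕ → Type
  | init (L : SingleQubitLayer N) : OneDimQAC N 0
  | layer {d : ℕ} (C : OneDimQAC N d) (M : CZLayer N) (L : SingleQubitLayer N) :
      OneDimQAC N (d + 1)

/-- The operator that a circuit performs. -/
def OneDimQAC.operator {N : ℕ} : {d : ℕ} → OneDimQAC N d →
    Matrix (Fin N → Bool) (Fin N → Bool) ℂ
  | _, .init L => L.operator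
  | _, .layer C M L => L.operator * M.operator * C.operator

/-- The amplitudes of `|x⟩ ⊗ |a⟩`: the input qubits, those in `I`, hold the basis state `x`, and
the other qubits, the ancilla, are in the joint state `a`. -/
def initialState {N : ℕ} {I : Finset (Fin N)} (a : EuclideanSpace ℂ ({j // j ∉ I} → Bool))
    (x : {i // i ∈ I} → Bool) : (Fin N → Bool) → ℂ :=
  fun y => if (∀ i : {i // i ∈ I}, y i = x i) then a (fun j => y j) else 0

/-- `f_C(x)`: the probability that measuring the qubit `q` of `C (|x⟩ ⊗ |a⟩)` in the computational
basis gives `1`. -/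
def OneDimQAC.acceptProb {N d : ℕ} (C : OneDimQAC N d) {I : Finset (Fin N)}
    (a : EuclideanSpace ℂ ({j // j ∉ I} → Bool)) (q : Fin N) (x : {i // i ∈ I} → Bool) : ℝ :=
  ∑ y : Fin N → Bool with y q = true, ‖(C.operator *ᵥ initialState a x) y‖ ^ 2

/-- The 2-norm of a function on the Boolean cube with respect to the uniform distribution. -/
def cubeNorm {ι : Type*} [Fintype ι] [DecidableEq ι] (f : (ι → Bool) → ℝ) : ℝ :=
  Real.sqrt ((∑ x, f x ^ 2) / 2 ^ Fintype.card ι)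

/-- The restriction of `f` under the partial assignment `z` to the variables in `S`: a function of
the variables outside `S`. -/
def restrict {ι : Type*} [DecidableEq ι] (f : (ι → Bool) → ℝ) (S : Finset ι)
    (z : {i // i ∈ S} → Bool) (y : {i // i ∉ S} → Bool) : ℝ :=
  f fun i => if h : i ∈ S then z ⟨i, h⟩ else y ⟨i, h⟩

end

/-! An operator acts on the region `J` only iff it commutes with every one-site observable outside
`J`, so light cones can be followed by conjugating observables. Suppose that a circuit with operator
`U` comes with a set `K` of inputs whose light cones lie in pairwise disjoint intervals, and let `T`
be a gate of the next layer. As `T` is an interval, it contains all the cones it touches, except at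
most two.

If `T` touches more than `m` cones, it contains the cones of a set `B` of at least `m - 1` inputs,
and deleting it is cheap on average over the inputs `x`. Indeed, the state `U (|x⟩ ⊗ |a⟩)` is fixed
by the projection `U P U*`, where `P` tests that the inputs in `B` agree with `x`. This projection
is supported in `T`, so the probability that all qubits of `T` are `1` is at most a diagonal entry
of it, and summing over `x` gives at most `2 ^ (n - |B|)`. The deleted gates contain at least
`m - 1` cones each, all distinct, hence there are few of them. The remaining gates touch at most
`m` cones, so keeping every `m`-th input of `K` leaves cones that no gate joins. With
`m = ⌊log₂ (n / ε)⌋` each layer divides the number of inputs by at most `m`, and the squared errors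
are controlled by the number of inputs lost, so that they telescope over the layers, Cauchy–Schwarz
costing only the factor `d`. In the end, after all the inputs outside `K` are fixed, the output
qubit lies in at most one light cone. When `m < 5` the error bound exceeds `1` and `f = 0` works. -/

theorem dependsOn_of_update {ι κ β : Type*} [Finite ι] [DecidableEq ι] {J : Set ι}
    {f : (ι → κ) → β} (hf : ∀ j ∉ J, ∀ x b, f (Function.update x j b) = f x) : DependsOn f J := by
  have := Fintype.ofFinite ι
  intro y x hyx
  have hpiecewise : ∀ s : Finset ι, f (s.piecewise y x) = f x := by
    intro s
    induction s using Finset.induction_on with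
    | empty => simp
    | insert j s _ ih =>
      rw [Finset.piecewise_insert]
      by_cases hj : j ∈ J
      · rwa [Function.update_eq_self_iff.2]
        by_cases hs : j ∈ s <;> simp [hs, hyx j hj]
      · rw [hf j hj, ih]
  simpa using hpiecewise Finset.univ

/-! ### Local observables -/

section LocalAlgebra

variable {ι κ : Type*} [Fintype ι] [DecidableEq ι] [DecidableEq κ]

/-- The one-site observable acting as `E` at the site `j` and as the identity elsewhere. -/
def siteOp (j : ι) (E : Matrix κ κ ℂ) : Matrix (ι → κ) (ι → κ) ℂ :=
  Matrix.of fun y x => if ∀ i, i ≠ j → y i = x i then E (y j) (x j) else 0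

theorem siteOp_conjTranspose (j : ι) (E : Matrix κ κ ℂ) : (siteOp j E)ᴴ = siteOp j Eᴴ := by
  ext y x
  simp only [Matrix.conjTranspose_apply, siteOp, Matrix.of_apply, eq_comm (a := x _),
    apply_ite star, star_zero]

variable [Fintype κ]

theorem siteOp_mulVec_apply (j : ι) (E : Matrix κ κ ℂ) (v : (ι → κ) → ℂ) (y : ι → κ) :
    (siteOp j E *ᵥ v) y = ∑ b, E (y j) b * v (Function.update y j b) := by
  simp only [Matrix.mulVec, dotProduct, siteOp, Matrix.of_apply]
  symm
  refine Finset.sum_of_injOn (Function.update y j) (Function.update_injective y j).injOn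
    (by simp) (fun z _ hz => ?_) fun b _ => ?_
  · rw [if_neg, zero_mul]
    refine fun h => hz ⟨z j, by simp, funext fun i => ?_⟩
    by_cases hi : i = j
    · rw [hi, Function.update_self]
    · rw [Function.update_of_ne hi, h i hi]
  · simp +contextual

theorem siteOp_mul_apply (j : ι) (E : Matrix κ κ ℂ) (A : Matrix (ι → κ) (ι → κ) ℂ)
    (y x : ι → κ) :
    (siteOp j E * A) y x = ∑ b, E (y j) b * A (Function.update y j b) x :=
  siteOp_mulVec_apply j E (A.col x) y

theorem mul_siteOp_apply (j : ι) (E : Matrix κ κ ℂ) (A : Matrix (ι → κ) (ι → κ) ℂ)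
    (y x : ι → κ) :
    (A * siteOp j E) y x = ∑ b, A y (Function.update x j b) * E b (x j) := by
  have h : A * siteOp j E = (siteOp j Eᴴ * Aᴴ)ᴴ := by
    rw [Matrix.conjTranspose_mul, siteOp_conjTranspose, Matrix.conjTranspose_conjTranspose,
      Matrix.conjTranspose_conjTranspose]
  rw [h, Matrix.conjTranspose_apply, siteOp_mul_apply]
  simp [mul_comm]

/-- The algebra of the observables localized in the region `J`, that is, of the operators of the
form `A ⊗ 1` with `A` acting on the sites in `J`. It is encoded as the commutant of the one-site
observables outside `J`. -/
def localAlgebra (J : Set ι) : StarSubalgebra ℂ (Matrix (ι → κ) (ι → κ) ℂ) :=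
  StarSubalgebra.centralizer ℂ {B | ∃ j ∉ J, ∃ E, siteOp j E = B}

theorem localAlgebra_mono {J J' : Set ι} (h : J ⊆ J') :
    localAlgebra (κ := κ) J ≤ localAlgebra J' :=
  StarSubalgebra.centralizer_le ℂ _ _ fun _ ⟨j, hj, hB⟩ => ⟨j, fun hjJ => hj (h hjJ), hB⟩

theorem mem_localAlgebra_iff_commute {J : Set ι} {A : Matrix (ι → κ) (ι → κ) ℂ} :
    A ∈ localAlgebra J ↔ ∀ j ∉ J, ∀ E, Commute A (siteOp j E) := by
  rw [localAlgebra, StarSubalgebra.mem_centralizer_iff]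
  refine ⟨fun h j hj E => ((h _ ⟨j, hj, E, rfl⟩).1).symm, ?_⟩
  rintro h _ ⟨j, hj, E, rfl⟩
  rw [Matrix.star_eq_conjTranspose, siteOp_conjTranspose]
  exact ⟨(h j hj E).symm, (h j hj Eᴴ).symm⟩

theorem mem_localAlgebra_iff {J : Set ι} {A : Matrix (ι → κ) (ι → κ) ℂ} :
    A ∈ localAlgebra J ↔ ∀ j ∉ J, ∀ y x : ι → κ, (y j ≠ x j → A y x = 0) ∧
      (y j = x j → ∀ b, A (Function.update y j b) (Function.update x j b) = A y x) := by
  rw [mem_localAlgebra_iff_commute]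
  refine forall₂_congr fun j _ => ⟨fun h y x => ?_, fun h E => ?_⟩
  · have matrixUnit (b c : κ) (y x : ι → κ) :
        (if b = y j then A (Function.update y j c) x else 0) =
          if c = x j then A y (Function.update x j b) else 0 := by
      simpa [siteOp_mul_apply, mul_siteOp_apply, Matrix.single_apply, ite_and] using
        (congrFun₂ (h (Matrix.single b c 1)).eq y x).symm
    refine ⟨fun hyx => ?_, fun hyx b => ?_⟩
    · simpa [hyx] using matrixUnit (y j) (y j) y x
    · simpa [hyx] using matrixUnit (y j) b y (Function.update x j b)
  · rw [commute_iff_eq]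
    ext y x
    rw [mul_siteOp_apply, siteOp_mul_apply, Finset.sum_eq_single (y j), Finset.sum_eq_single (x j)]
    · rw [mul_comm, ← (h y (Function.update x j (y j))).2 (by simp) (x j)]
      simp
    · intro b _ hb
      rw [(h (Function.update y j b) x).1 (by simpa using hb), mul_zero]
    · simp
    · intro b _ hb
      rw [(h y (Function.update x j b)).1 (by simpa using hb.symm), zero_mul]
    · simp

theorem siteOp_mem_localAlgebra (j : ι) (E : Matrix κ κ ℂ) : siteOp j E ∈ localAlgebra {j} := by
  refine mem_localAlgebra_iff.2 fun i hi y x =>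
    ⟨fun h => if_neg fun h' => h (h' i hi), fun h b => ?_⟩
  have hij : j ≠ i := Ne.symm hi
  simp only [siteOp, Matrix.of_apply, Function.update_of_ne hij]
  refine if_congr (forall₂_congr fun k _ => ?_) rfl rfl
  by_cases hk : k = i
  · simp [hk, h]
  · simp [hk]

theorem diagonal_mem_localAlgebra {J : Set ι} {f : (ι → κ) → ℂ} (hf : DependsOn f J) :
    Matrix.diagonal f ∈ localAlgebra J := by
  refine mem_localAlgebra_iff.2 fun j hj y x => ⟨fun h => ?_, fun h b => ?_⟩
  · exact Matrix.diagonal_apply_ne _ fun hyx => h (congrFun hyx j)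
  · by_cases hyx : y = x
    · subst hyx
      simp only [Matrix.diagonal_apply_eq]
      exact hf fun i hi => Function.update_of_ne (fun hij => hj (by rwa [← hij])) _ _
    · rw [Matrix.diagonal_apply_ne _ hyx, Matrix.diagonal_apply_ne]
      intro hup
      refine hyx (funext fun i => ?_)
      by_cases hi : i = j
      · rw [hi, h]
      · simpa [hi] using congrFun hup i

theorem apply_eq_zero_of_mem_localAlgebra {J : Set ι} {A : Matrix (ι → κ) (ι → κ) ℂ}
    (hA : A ∈ localAlgebra J) {y x : ι → κ} {j : ι} (hj : j ∉ J) (hyx : y j ≠ x j) : A y x = 0 :=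
  (mem_localAlgebra_iff.1 hA j hj y x).1 hyx

theorem apply_self_congr_of_mem_localAlgebra {J : Set ι} {A : Matrix (ι → κ) (ι → κ) ℂ}
    (hA : A ∈ localAlgebra J) {y x : ι → κ} (hyx : ∀ i ∈ J, y i = x i) : A y y = A x x := by
  suffices DependsOn (fun y => A y y) J from this hyx
  exact dependsOn_of_update fun j hj y b => (mem_localAlgebra_iff.1 hA j hj y y).2 rfl b

theorem commute_diagonal_of_mem_localAlgebra {J : Set ι} {A : Matrix (ι → κ) (ι → κ) ℂ}
    (hA : A ∈ localAlgebra J) {f : (ι → κ) → ℂ} (hf : DependsOn f Jᶜ) :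
    Commute A (Matrix.diagonal f) := by
  rw [commute_iff_eq]
  ext y x
  rw [Matrix.mul_diagonal, Matrix.diagonal_mul, mul_comm]
  by_cases h : ∀ j ∈ Jᶜ, y j = x j
  · rw [hf h]
  · push Not at h
    obtain ⟨j, hj, hyx⟩ := h
    rw [apply_eq_zero_of_mem_localAlgebra hA hj hyx, mul_zero, mul_zero]

end LocalAlgebra

/-! ### The Heisenberg picture -/

section Heisenberg

variable {ι κ : Type*} [Fintype ι] [DecidableEq ι] [Fintype κ] [DecidableEq κ]

/-- In the Heisenberg picture, the unitary `U` moves the observables localized in `J` to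
observables localized in `J'`: the forward light cone of `J` under `U` is contained in `J'`. -/
def SpreadsInto (U : Matrix.unitaryGroup (ι → κ) ℂ) (J J' : Set ι) : Prop :=
  ∀ A ∈ localAlgebra J, Unitary.conjStarAlgAut ℂ _ U A ∈ localAlgebra J'

theorem SpreadsInto.trans {U V : Matrix.unitaryGroup (ι → κ) ℂ} {J J' J'' : Set ι}
    (hU : SpreadsInto U J J') (hV : SpreadsInto V J' J'') : SpreadsInto (V * U) J J'' :=
  fun A hA => by
    rw [map_mul]
    exact hV _ (hU A hA)

theorem spreadsInto_of_conj_siteOp {U : Matrix.unitaryGroup (ι → κ) ℂ}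
    (hU : ∀ j E, ∃ E', siteOp j E = Unitary.conjStarAlgAut ℂ _ U (siteOp j E')) (J : Set ι) :
    SpreadsInto U J J := by
  refine fun A hA => mem_localAlgebra_iff_commute.2 fun j hj E => ?_
  obtain ⟨E', hE'⟩ := hU j E
  rw [hE']
  exact (mem_localAlgebra_iff_commute.1 hA j hj E').map _

theorem spreadsInto_of_eq_diagonal_mul {U : Matrix.unitaryGroup (ι → κ) ℂ} {J J' : Set ι}
    {f g : (ι → κ) → ℂ} (hU : U.1 = Matrix.diagonal f * Matrix.diagonal g)
    (hJ : J ⊆ J') (hf : DependsOn f J') (hg : DependsOn g Jᶜ)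
    (hg_unit : Matrix.diagonal g ∈ Matrix.unitaryGroup (ι → κ) ℂ) : SpreadsInto U J J' := by
  intro A hA
  have hconj : Unitary.conjStarAlgAut ℂ _ U A =
      Matrix.diagonal f * A * star (Matrix.diagonal f) := by
    have hcomm := (commute_diagonal_of_mem_localAlgebra hA hg).eq
    calc U.1 * A * star U.1
        = Matrix.diagonal f * (Matrix.diagonal g * A) *
            (star (Matrix.diagonal g) * star (Matrix.diagonal f)) := by
          rw [hU, star_mul, mul_assoc (Matrix.diagonal f)]
      _ = Matrix.diagonal f * A * (Matrix.diagonal g * star (Matrix.diagonal g)) *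
            star (Matrix.diagonal f) := by
          rw [← hcomm]
          simp only [mul_assoc]
      _ = Matrix.diagonal f * A * star (Matrix.diagonal f) := by
          rw [Matrix.mem_unitaryGroup_iff.1 hg_unit, mul_one]
  have hf_mem := diagonal_mem_localAlgebra hf
  rw [hconj]
  exact mul_mem (mul_mem hf_mem (localAlgebra_mono hJ hA)) (star_mem hf_mem)

end Heisenberg

theorem tensorOperator_mul {N : ℕ} (U V : Fin N → Matrix Bool Bool ℂ) :
    tensorOperator (U * V) = tensorOperator U * tensorOperator V := by
  ext y x
  simp only [tensorOperator, Matrix.of_apply, Matrix.mul_apply, Pi.mul_apply,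
    Finset.prod_univ_sum, Finset.prod_mul_distrib, Fintype.piFinset_univ]

theorem tensorOperator_conjTranspose {N : ℕ} (U : Fin N → Matrix Bool Bool ℂ) :
    (tensorOperator U)ᴴ = tensorOperator (star U) := by
  ext y x
  simp [tensorOperator, Matrix.star_apply]

theorem tensorOperator_mulSingle {N : ℕ} (j : Fin N) (E : Matrix Bool Bool ℂ) :
    tensorOperator (Pi.mulSingle j E) = siteOp j E := by
  ext y x
  rw [tensorOperator, Matrix.of_apply, ← Finset.mul_prod_erase _ _ (Finset.mem_univ j),
    Pi.mulSingle_eq_same]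
  have hoff : ∀ i ∈ Finset.univ.erase j,
      (Pi.mulSingle j E : Fin N → Matrix Bool Bool ℂ) i (y i) (x i) =
        if y i = x i then 1 else 0 := by
    intro i hi
    rw [Pi.mulSingle_eq_of_ne (Finset.ne_of_mem_erase hi), Matrix.one_apply]
  rw [Finset.prod_congr rfl hoff, Finset.prod_ite_zero]
  simp [siteOp]

theorem tensorOperator_one {N : ℕ} : tensorOperator (1 : Fin N → Matrix Bool Bool ℂ) = 1 := by
  ext y x
  simp only [tensorOperator, Matrix.of_apply, Pi.one_apply, Matrix.one_apply,
    Finset.prod_ite_zero, Finset.prod_const_one, Finset.mem_univ, true_imp_iff, funext_iff]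

namespace SingleQubitLayer

variable {N : ℕ}

/-- The operator of a single-qubit layer as an element of the unitary group. -/
def toUnitary (L : SingleQubitLayer N) : Matrix.unitaryGroup (Fin N → Bool) ℂ :=
  ⟨L.operator, by
    rw [Matrix.mem_unitaryGroup_iff', Matrix.star_eq_conjTranspose, operator,
      tensorOperator_conjTranspose, ← tensorOperator_mul, ← tensorOperator_one]
    congr 1
    funext i
    exact Unitary.coe_star_mul_self (L i)⟩

theorem spreadsInto (L : SingleQubitLayer N) (J : Set (Fin N)) : SpreadsInto L.toUnitary J J := by
  refine spreadsInto_of_conj_siteOp (fun j E => ⟨star (L j).1 * E * (L j).1, ?_⟩) J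
  rw [Unitary.conjStarAlgAut_apply]
  change _ = tensorOperator _ * _ * (tensorOperator _)ᴴ
  rw [tensorOperator_conjTranspose, ← tensorOperator_mulSingle, ← tensorOperator_mulSingle,
    ← tensorOperator_mul, ← tensorOperator_mul]
  congr 1
  funext i
  by_cases hi : i = j
  · subst hi
    have hL : (L i).1 * star (L i).1 = 1 := Unitary.coe_mul_star_self (L i)
    simp only [Pi.mul_apply, Pi.star_apply, Pi.mulSingle_eq_same]
    simp only [← mul_assoc, hL, one_mul]
    rw [mul_assoc, hL, mul_one]
  · simp [hi]

end SingleQubitLayer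

section ControlledZ

variable {N : ℕ}

/-- The diagonal entries of `czGate T`. -/
def czSign (T : Finset (Fin N)) (x : Fin N → Bool) : ℂ := if ∀ i ∈ T, x i = true then -1 else 1

theorem dependsOn_czSign (T : Finset (Fin N)) : DependsOn (czSign T) T := fun x y h =>
  if_congr (forall₂_congr fun i hi => by rw [h i hi]) rfl rfl

theorem czGate_mem_unitaryGroup (T : Finset (Fin N)) :
    czGate T ∈ Matrix.unitaryGroup (Fin N → Bool) ℂ := by
  rw [Matrix.mem_unitaryGroup_iff, Matrix.star_eq_conjTranspose, czGate,
    Matrix.diagonal_conjTranspose, Matrix.diagonal_mul_diagonal, ← Matrix.diagonal_one]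
  congr 1
  funext x
  rw [Pi.star_apply]
  split_ifs <;> simp

theorem diagonal_prod_czSign_mem_unitaryGroup (s : Finset (Finset (Fin N))) :
    Matrix.diagonal (∏ T ∈ s, czSign T) ∈ Matrix.unitaryGroup (Fin N → Bool) ℂ :=
  prod_mem (S := (Matrix.unitaryGroup (Fin N → Bool) ℂ).comap
    (Matrix.diagonalRingHom (Fin N → Bool) ℂ)) fun T _ => czGate_mem_unitaryGroup T

theorem dependsOn_prod_czSign {s : Finset (Finset (Fin N))} {J : Set (Fin N)}
    (h : ∀ T ∈ s, ↑T ⊆ J) : DependsOn (∏ T ∈ s, czSign T) J := fun x y hxy => by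
  simp only [Finset.prod_apply]
  exact Finset.prod_congr rfl fun T hT => dependsOn_czSign T fun i hi => hxy i (h T hT hi)

namespace CZLayer

theorem operator_eq_diagonal (M : CZLayer N) :
    M.operator = Matrix.diagonal (∏ T ∈ M.gates, czSign T) := by
  rw [← Finset.noncommProd_eq_prod]
  exact (Finset.map_noncommProd _ _ _ (Matrix.diagonalRingHom (Fin N → Bool) ℂ)).symm

/-- The operator of a layer of CZ gates as an element of the unitary group. -/
def toUnitary (M : CZLayer N) : Matrix.unitaryGroup (Fin N → Bool) ℂ :=
  ⟨M.operator, M.operator_eq_diagonal ▸ diagonal_prod_czSign_mem_unitaryGroup M.gates⟩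

/-- The forward light cone of `J` under `M`: the set `J` together with the gates touching it. -/
def spread (M : CZLayer N) (J : Finset (Fin N)) : Finset (Fin N) :=
  J ∪ (M.gates.filter fun T => ¬Disjoint T J).biUnion id

theorem mem_spread {M : CZLayer N} {J : Finset (Fin N)} {j : Fin N} :
    j ∈ M.spread J ↔ j ∈ J ∨ ∃ T ∈ M.gates, ¬Disjoint T J ∧ j ∈ T := by
  simp only [spread, Finset.mem_union, Finset.mem_biUnion, Finset.mem_filter, and_assoc, id]

theorem subset_spread (M : CZLayer N) (J : Finset (Fin N)) : J ⊆ M.spread J :=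
  Finset.subset_union_left

theorem spreadsInto (M : CZLayer N) (J : Finset (Fin N)) :
    SpreadsInto M.toUnitary J (M.spread J) := by
  refine spreadsInto_of_eq_diagonal_mul (f := ∏ T ∈ M.gates with ¬Disjoint T J, czSign T)
    (g := ∏ T ∈ M.gates with ¬¬Disjoint T J, czSign T) ?_ (M.subset_spread J)
    (dependsOn_prod_czSign fun T hT j hj => ?_) (dependsOn_prod_czSign fun T hT => ?_)
    (diagonal_prod_czSign_mem_unitaryGroup _)
  · rw [Matrix.diagonal_mul_diagonal']
    exact M.operator_eq_diagonal.trans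
      (congrArg _ (Finset.prod_filter_mul_prod_filter_not M.gates _ czSign).symm)
  · rw [Finset.mem_filter] at hT
    exact mem_spread.2 (Or.inr ⟨T, hT.1, hT.2, hj⟩)
  · rw [Finset.mem_filter, not_not] at hT
    exact Set.subset_compl_iff_disjoint_right.2 (Finset.disjoint_coe.2 hT.2)

theorem ordConnected_spread (M : CZLayer N) {J : Finset (Fin N)} (hJ : J.Nonempty)
    (hJc : (J : Set (Fin N)).OrdConnected) : (M.spread J : Set (Fin N)).OrdConnected := by
  obtain ⟨c, hc⟩ := hJ
  refine Set.ordConnected_of_uIcc_subset_left (x := c) fun x hx z hz => ?_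
  rw [Finset.mem_coe, mem_spread] at hx ⊢
  rcases hx with hx | ⟨T, hT, hTJ, hx⟩
  · exact Or.inl (hJc.uIcc_subset hc hx hz)
  · obtain ⟨w, hwT, hwJ⟩ := Finset.not_disjoint_iff.1 hTJ
    rcases Set.uIcc_subset_uIcc_union_uIcc (b := w) hz with hz | hz
    · exact Or.inl (hJc.uIcc_subset hc hwJ hz)
    · exact Or.inr ⟨T, hT, hTJ, (M.interval T hT).uIcc_subset hwT hx hz⟩

theorem disjoint_spread (M : CZLayer N) {A B : Finset (Fin N)} (hAB : Disjoint A B)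
    (h : ∀ T ∈ M.gates, Disjoint T A ∨ Disjoint T B) : Disjoint (M.spread A) (M.spread B) := by
  refine Finset.disjoint_left.2 fun x hxA hxB => ?_
  rcases mem_spread.1 hxA with hxA | ⟨T, hT, hTA, hxT⟩ <;>
    rcases mem_spread.1 hxB with hxB | ⟨T', hT', hTB, hxT'⟩
  · exact Finset.disjoint_left.1 hAB hxA hxB
  · exact (h T' hT').elim (fun h => Finset.disjoint_left.1 h hxT' hxA) hTB
  · exact (h T hT).elim hTA fun h => Finset.disjoint_left.1 h hxT hxB
  · obtain rfl : T = T' := M.disjoint.elim_finset hT hT' x hxT hxT'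
    exact (h T hT).elim hTA hTB

/-- The layer of those gates of `M` that satisfy `p`. -/
def filter (M : CZLayer N) (p : Finset (Fin N) → Prop) [DecidablePred p] : CZLayer N where
  gates := M.gates.filter p
  nonempty T hT := M.nonempty T (Finset.mem_filter.1 hT).1
  interval T hT := M.interval T (Finset.mem_filter.1 hT).1
  disjoint := M.disjoint.subset (Finset.coe_subset.2 (Finset.filter_subset p M.gates))

end CZLayer

end ControlledZ

/-- The operator of a circuit as an element of the unitary group. -/
def OneDimQAC.toUnitary {N : ℕ} : {d : ℕ} → OneDimQAC N d → Matrix.unitaryGroup (Fin N → Bool) ℂ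
  | _, .init L => L.toUnitary
  | _, .layer C M L => L.toUnitary * M.toUnitary * C.toUnitary

theorem OneDimQAC.coe_toUnitary {N d : ℕ} (C : OneDimQAC N d) : C.toUnitary.1 = C.operator := by
  induction C with
  | init L => rfl
  | layer C M L ih => exact congrArg (L.operator * M.operator * ·) ih

/-! ### Projections onto basis states -/

section Norms

variable {m k : Type*} [Fintype m] [Fintype k]

theorem norm_toLp_mulVec_of_mem_unitaryGroup [DecidableEq m] {U : Matrix m m ℂ}
    (hU : U ∈ Matrix.unitaryGroup m ℂ) (v : m → ℂ) :
    ‖WithLp.toLp 2 (U *ᵥ v)‖ = ‖WithLp.toLp 2 v‖ := by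
  rw [← Matrix.toEuclideanCLM_toLp]
  exact ContinuousLinearMap.norm_map_of_mem_unitary
    (Unitary.map_mem (Matrix.toEuclideanCLM (n := m) (𝕜 := ℂ)) hU) _

open scoped Matrix.Norms.Frobenius

theorem frobenius_norm_sq_eq_sum (W : Matrix m k ℂ) : ‖W‖ ^ 2 = ∑ y, ∑ x, ‖W y x‖ ^ 2 := by
  rw [Matrix.frobenius_norm_def, ← Real.sqrt_eq_rpow, Real.sq_sqrt (by positivity)]
  simp only [Real.rpow_ofNat]

theorem frobenius_norm_sq_eq_sum_col (W : Matrix m k ℂ) :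
    ‖W‖ ^ 2 = ∑ x, ‖WithLp.toLp 2 (W.col x)‖ ^ 2 := by
  rw [frobenius_norm_sq_eq_sum, Finset.sum_comm]
  simp only [EuclideanSpace.norm_sq_eq, Matrix.col_apply]

theorem frobenius_norm_diagonal_mul_sq [DecidableEq m] (f : m → ℂ) (W : Matrix m k ℂ) :
    ‖Matrix.diagonal f * W‖ ^ 2 = ∑ y, ‖f y‖ ^ 2 * ∑ x, ‖W y x‖ ^ 2 := by
  rw [frobenius_norm_sq_eq_sum]
  simp only [Matrix.diagonal_mul, norm_mul, mul_pow, Finset.mul_sum]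

theorem frobenius_norm_unitary_mul [DecidableEq m] {U : Matrix m m ℂ}
    (hU : U ∈ Matrix.unitaryGroup m ℂ) (W : Matrix m k ℂ) : ‖U * W‖ = ‖W‖ := by
  rw [← sq_eq_sq₀ (norm_nonneg _) (norm_nonneg _), frobenius_norm_sq_eq_sum_col,
    frobenius_norm_sq_eq_sum_col]
  refine Finset.sum_congr rfl fun x _ => ?_
  rw [← norm_toLp_mulVec_of_mem_unitaryGroup hU (W.col x)]
  rfl

end Norms

section BasisProjection

variable {m : Type*} [DecidableEq m]

/-- The orthogonal projection onto the span of the basis states in `s`: measuring the state `v` in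
the computational basis gives an element of `s` with probability `‖basisProjection s *ᵥ v‖ ^ 2`. -/
noncomputable def basisProjection (s : Set m) : Matrix m m ℂ := Matrix.diagonal (s.indicator 1)

variable [Fintype m]

theorem isStarProjection_basisProjection (s : Set m) : IsStarProjection (basisProjection s) where
  isIdempotentElem := by
    rw [IsIdempotentElem, basisProjection, Matrix.diagonal_mul_diagonal]
    congr 1
    funext y
    by_cases hy : y ∈ s <;> simp [hy]
  isSelfAdjoint := by
    rw [IsSelfAdjoint, basisProjection, Matrix.star_eq_conjTranspose,
      Matrix.diagonal_conjTranspose]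
    congr 1
    funext y
    by_cases hy : y ∈ s <;> simp [hy]

theorem basisProjection_mulVec (s : Set m) (v : m → ℂ) :
    basisProjection s *ᵥ v = s.indicator v := by
  funext y
  rw [basisProjection, Matrix.mulVec_diagonal]
  by_cases hy : y ∈ s <;> simp [hy]

open scoped Matrix.Norms.L2Operator in
theorem norm_toLp_basisProjection_mulVec_le (s : Set m) (v : m → ℂ) :
    ‖WithLp.toLp 2 (basisProjection s *ᵥ v)‖ ≤ ‖WithLp.toLp 2 v‖ :=
  (Matrix.l2_opNorm_mulVec _ (WithLp.toLp 2 v)).trans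
    (mul_le_of_le_one_left (norm_nonneg _) (isStarProjection_basisProjection s).norm_le)

variable {ι κ : Type*} [Fintype ι] [DecidableEq ι] [Fintype κ] [DecidableEq κ]

theorem basisProjection_mul_mul_basisProjection {J : Set ι} {A : Matrix (ι → κ) (ι → κ) ℂ}
    (hA : A ∈ localAlgebra J) (c : ι → κ) :
    basisProjection {y | J.EqOn y c} * A * basisProjection {y | J.EqOn y c} =
      A c c • basisProjection {y | J.EqOn y c} := by
  ext y x
  rw [basisProjection, Matrix.mul_diagonal, Matrix.diagonal_mul, Matrix.smul_apply]
  by_cases hy : J.EqOn y c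
  · by_cases hx : J.EqOn x c
    · by_cases hyx : y = x
      · subst hyx
        simp [hy, apply_self_congr_of_mem_localAlgebra hA hy]
      · obtain ⟨j, hj⟩ := Function.ne_iff.1 hyx
        have hjJ : j ∉ J := fun hjJ => hj ((hy hjJ).trans (hx hjJ).symm)
        simp [hyx, apply_eq_zero_of_mem_localAlgebra hA hjJ hj]
    · have hyx : y ≠ x := fun h => hx (h ▸ hy)
      simp [hx, hyx]
  · simp [hy, Matrix.diagonal_apply]

open scoped Matrix.Norms.L2Operator ComplexOrder in
theorem norm_toLp_basisProjection_mulVec_sq_le {J : Set ι} {Q : Matrix (ι → κ) (ι → κ) ℂ}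
    (hQ : IsStarProjection Q) (hQJ : Q ∈ localAlgebra J) {v : (ι → κ) → ℂ} (hv : Q *ᵥ v = v)
    (c : ι → κ) : ‖WithLp.toLp 2 (basisProjection {y | J.EqOn y c} *ᵥ v)‖ ^ 2 ≤
      (Q c c).re * ‖WithLp.toLp 2 v‖ ^ 2 := by
  set P := basisProjection {y : ι → κ | J.EqOn y c}
  have hP : IsStarProjection P := isStarProjection_basisProjection _
  have hQcc : ‖Q c c‖ = (Q c c).re := by
    have hpos := (Matrix.posSemidef_self_mul_conjTranspose Q).diag_nonneg (i := c)
    rw [← Matrix.star_eq_conjTranspose, hQ.isSelfAdjoint.star_eq,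
      hQ.isIdempotentElem.eq] at hpos
    exact (Complex.re_eq_norm.2 hpos).symm
  have hPQ : ‖P * Q‖ * ‖P * Q‖ ≤ (Q c c).re :=
    calc ‖P * Q‖ * ‖P * Q‖ = ‖P * Q * star (P * Q)‖ := CStarRing.norm_self_mul_star.symm
      _ = ‖P * Q * P‖ := by
        rw [star_mul, hQ.isSelfAdjoint.star_eq, hP.isSelfAdjoint.star_eq, mul_assoc,
          ← mul_assoc Q, hQ.isIdempotentElem.eq, mul_assoc]
      _ = ‖Q c c • P‖ := by rw [basisProjection_mul_mul_basisProjection hQJ]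
      _ ≤ (Q c c).re := by
        rw [norm_smul, hQcc]
        exact mul_le_of_le_one_right (hQcc ▸ norm_nonneg _) hP.norm_le
  calc ‖WithLp.toLp 2 (P *ᵥ v)‖ ^ 2 = ‖WithLp.toLp 2 ((P * Q) *ᵥ v)‖ ^ 2 := by
        rw [← Matrix.mulVec_mulVec, hv]
    _ ≤ (‖P * Q‖ * ‖WithLp.toLp 2 v‖) ^ 2 := by
        gcongr
        exact Matrix.l2_opNorm_mulVec _ (WithLp.toLp 2 v)
    _ ≤ (Q c c).re * ‖WithLp.toLp 2 v‖ ^ 2 := by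
        rw [mul_pow, sq ‖P * Q‖]
        gcongr

end BasisProjection

theorem conj_diagonal_prod_mem_localAlgebra {ι κ β : Type*} [Fintype ι] [DecidableEq ι] [Fintype κ]
    [DecidableEq κ] {U : Matrix.unitaryGroup (ι → κ) ℂ} {s : Finset β} {J : β → Set ι}
    {J' : Set ι} {f : β → (ι → κ) → ℂ} (hU : ∀ b ∈ s, SpreadsInto U (J b) J')
    (hf : ∀ b ∈ s, DependsOn (f b) (J b)) :
    Unitary.conjStarAlgAut ℂ _ U (Matrix.diagonal (∏ b ∈ s, f b)) ∈ localAlgebra J' :=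
  prod_mem (S := (localAlgebra J').toSubalgebra.comap
      ((Unitary.conjStarAlgAut ℂ _ U).toAlgEquiv.toAlgHom.comp (Matrix.diagonalAlgHom ℂ)))
    fun b hb => hU b hb _ (diagonal_mem_localAlgebra (hf b hb))

section InitialState

variable {N : ℕ} {I : Finset (Fin N)}

theorem norm_toLp_initialState (a : EuclideanSpace ℂ ({j // j ∉ I} → Bool))
    (x : {i // i ∈ I} → Bool) : ‖WithLp.toLp 2 (initialState a x)‖ = ‖a‖ := by
  rw [← sq_eq_sq₀ (norm_nonneg _) (norm_nonneg _), EuclideanSpace.norm_sq_eq,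
    EuclideanSpace.norm_sq_eq,
    ← (Equiv.piEquivPiSubtypeProd (· ∈ I) fun _ => Bool).symm.sum_comp, Fintype.sum_prod_type,
    Finset.sum_eq_single x]
  · refine Finset.sum_congr rfl fun w _ => ?_
    congr 2
    simp only [initialState, Equiv.piEquivPiSubtypeProd, Equiv.coe_fn_symm_mk, Subtype.coe_eta,
      Finset.coe_mem, dif_pos, implies_true, if_true]
    exact congrArg a.ofLp (funext fun j => dif_neg j.2)
  · intro u _ hu
    refine Finset.sum_eq_zero fun w _ => ?_
    rw [PiLp.toLp_apply, initialState, if_neg, norm_zero, zero_pow two_ne_zero]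
    exact fun h => hu (funext fun i => by simpa [Equiv.piEquivPiSubtypeProd] using h i)
  · simp

/-- The matrix whose columns are the initial states of the circuit on all the inputs. -/
def inputMatrix (a : EuclideanSpace ℂ ({j // j ∉ I} → Bool)) :
    Matrix (Fin N → Bool) ({i // i ∈ I} → Bool) ℂ :=
  (Matrix.of (initialState a))ᵀ

/-- The projection onto the basis states whose input qubits in `B` agree with `x`. -/
noncomputable def inputProjection (B : Finset {i // i ∈ I}) (x : {i // i ∈ I} → Bool) :
    Matrix (Fin N → Bool) (Fin N → Bool) ℂ :=
  basisProjection {y | ∀ i ∈ B, y i = x i}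

theorem inputProjection_mulVec_initialState (a : EuclideanSpace ℂ ({j // j ∉ I} → Bool))
    (B : Finset {i // i ∈ I}) (x : {i // i ∈ I} → Bool) :
    inputProjection B x *ᵥ initialState a x = initialState a x := by
  rw [inputProjection, basisProjection_mulVec, Set.indicator_eq_self]
  intro y hy i _
  by_contra h
  exact hy (if_neg fun h' => h (h' i))

theorem conj_inputProjection_mem_localAlgebra {U : Matrix.unitaryGroup (Fin N → Bool) ℂ}
    {B : Finset {i // i ∈ I}} {J : Set (Fin N)} (hU : ∀ i ∈ B, SpreadsInto U {i.1} J)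
    (x : {i // i ∈ I} → Bool) :
    Unitary.conjStarAlgAut ℂ _ U (inputProjection B x) ∈ localAlgebra J := by
  have hprod : {y : Fin N → Bool | ∀ i ∈ B, y i = x i}.indicator 1 =
      ∏ i ∈ B, fun y : Fin N → Bool => if y i = x i then (1 : ℂ) else 0 := by
    funext y
    simp [Finset.prod_ite_zero, Set.indicator_apply]
  rw [inputProjection, basisProjection, hprod]
  exact conj_diagonal_prod_mem_localAlgebra hU fun i _ y z hyz => by rw [hyz i.1 rfl]

theorem sum_inputProjection (B : Finset {i // i ∈ I}) :
    ∑ x, inputProjection B x = (2 ^ Bᶜ.card : ℂ) • 1 := by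
  have hcount : ∑ x : {i // i ∈ I} → Bool, {y : Fin N → Bool | ∀ i ∈ B, y i = x i}.indicator 1 =
      fun _ : Fin N → Bool => (2 ^ Bᶜ.card : ℂ) := by
    funext y
    calc (∑ x : {i // i ∈ I} → Bool, {y : Fin N → Bool | ∀ i ∈ B, y i = x i}.indicator 1) y
        = ∑ x : {i // i ∈ I} → Bool, ∏ i, if i ∈ B → y i = x i then (1 : ℂ) else 0 := by
          simp [Finset.prod_ite_zero, Set.indicator_apply]
      _ = ∏ i, ∑ b, if i ∈ B → y i = b then (1 : ℂ) else 0 := by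
          rw [Finset.prod_univ_sum, Fintype.piFinset_univ]
      _ = ∏ i, if i ∈ Bᶜ then (2 : ℂ) else 1 := by
          refine Finset.prod_congr rfl fun i _ => ?_
          by_cases hi : i ∈ B <;> simp [hi]
      _ = 2 ^ Bᶜ.card := by
          rw [Finset.prod_ite_mem, Finset.univ_inter, Finset.prod_const]
  rw [Matrix.smul_one_eq_diagonal, ← hcount]
  exact (map_sum (Matrix.diagonalAddMonoidHom (Fin N → Bool) ℂ) _ _).symm

open scoped Matrix.Norms.Frobenius in
theorem norm_basisProjection_mul_inputMatrix_sq_le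
    {U : Matrix.unitaryGroup (Fin N → Bool) ℂ} {B : Finset {i // i ∈ I}} {J : Set (Fin N)}
    (hU : ∀ i ∈ B, SpreadsInto U {i.1} J) {a : EuclideanSpace ℂ ({j // j ∉ I} → Bool)}
    (ha : ‖a‖ = 1) (c : Fin N → Bool) :
    ‖basisProjection {y | J.EqOn y c} * (U.1 * inputMatrix a)‖ ^ 2 ≤ 2 ^ Bᶜ.card := by
  set Q := fun x => Unitary.conjStarAlgAut ℂ _ U (inputProjection B x)
  have hQ_mulVec (x) : Q x *ᵥ (U.1 *ᵥ initialState a x) = U.1 *ᵥ initialState a x := by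
    have hQU : Q x * U.1 = U.1 * inputProjection B x := by
      simp only [Q, Unitary.conjStarAlgAut_apply, mul_assoc, Unitary.coe_star_mul_self, mul_one]
    rw [Matrix.mulVec_mulVec, hQU, ← Matrix.mulVec_mulVec, inputProjection_mulVec_initialState]
  have hnorm (x) : ‖WithLp.toLp 2 (U.1 *ᵥ initialState a x)‖ = 1 := by
    rw [norm_toLp_mulVec_of_mem_unitaryGroup U.2, norm_toLp_initialState, ha]
  calc ‖basisProjection {y | J.EqOn y c} * (U.1 * inputMatrix a)‖ ^ 2
      = ∑ x, ‖WithLp.toLp 2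
          (basisProjection {y | J.EqOn y c} *ᵥ (U.1 *ᵥ initialState a x))‖ ^ 2 :=
        frobenius_norm_sq_eq_sum_col _
    _ ≤ ∑ x, (Q x c c).re := Finset.sum_le_sum fun x _ => by
        have := norm_toLp_basisProjection_mulVec_sq_le
          ((isStarProjection_basisProjection _).map (Unitary.conjStarAlgAut ℂ _ U))
          (conj_inputProjection_mem_localAlgebra hU x) (hQ_mulVec x) c
        rwa [hnorm, one_pow, mul_one] at this
    _ = ((∑ x, Q x) c c).re := by rw [Matrix.sum_apply, Complex.re_sum]
    _ = 2 ^ Bᶜ.card := by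
        rw [← map_sum, sum_inputProjection, map_smul, map_one, Matrix.smul_apply,
          Matrix.one_apply_eq, smul_eq_mul, mul_one]
        norm_cast

end InitialState

/-! ### Disjoint light cones -/

theorem exists_sparse_subset {α : Type*} [LinearOrder α] (K : Finset α) {m : ℕ} (hm : 0 < m) :
    ∃ K' ⊆ K, K.card ≤ m * K'.card ∧ m * K'.card < K.card + m ∧
      ∀ i ∈ K', ∀ j ∈ K', i < j → m < {k ∈ K | i ≤ k ∧ k ≤ j}.card := by
  have hcard_le : K.card ≤ m * (K.card ⌈/⌉ m) := le_smul_ceilDiv hm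
  have hcard_lt : m * (K.card ⌈/⌉ m) < K.card + m :=
    (Nat.mul_div_le _ _).trans_lt (Nat.sub_lt (by omega) one_pos)
  have hlt (t : Fin (K.card ⌈/⌉ m)) : m * t < K.card := by
    have : m * (t + 1) ≤ m * (K.card ⌈/⌉ m) := Nat.mul_le_mul_left m t.2
    linarith
  set e := K.orderEmbOfFin rfl
  set φ : Fin (K.card ⌈/⌉ m) → α := fun t => e ⟨m * t, hlt t⟩
  have hφ : StrictMono φ := fun s t hst =>
    e.strictMono (Fin.mk_lt_mk.2 (Nat.mul_lt_mul_of_pos_left hst hm))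
  have hcard : (Finset.univ.image φ).card = K.card ⌈/⌉ m := by
    rw [Finset.card_image_of_injective _ hφ.injective, Finset.card_univ, Fintype.card_fin]
  refine ⟨Finset.univ.image φ, Finset.image_subset_iff.2 fun t _ => K.orderEmbOfFin_mem rfl _,
    hcard.symm ▸ hcard_le, hcard.symm ▸ hcard_lt, fun i hi j hj hij => ?_⟩
  obtain ⟨s, -, rfl⟩ := Finset.mem_image.1 hi
  obtain ⟨t, -, rfl⟩ := Finset.mem_image.1 hj
  have hst : m * (s + 1) ≤ m * t := Nat.mul_le_mul_left m (hφ.lt_iff_lt.1 hij)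
  have hsub : (Finset.Icc ⟨m * s, hlt s⟩ ⟨m * t, hlt t⟩).map e.toEmbedding ⊆
      {k ∈ K | φ s ≤ k ∧ k ≤ φ t} := by
    intro k hk
    obtain ⟨u, hu, rfl⟩ := Finset.mem_map.1 hk
    rw [Finset.mem_Icc] at hu
    exact Finset.mem_filter.2 ⟨K.orderEmbOfFin_mem rfl _, e.monotone hu.1, e.monotone hu.2⟩
  have hle := Finset.card_le_card hsub
  rw [Finset.card_map, Fin.card_Icc] at hle
  rw [mul_add] at hst
  dsimp only at hle
  omega

/-- The intervals `J i`, for `i ∈ K`, are pairwise disjoint and contain the light cones of the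
input qubits `i` under the evolution `U`. -/
structure DisjointLightCones {N : ℕ} {I : Finset (Fin N)}
    (U : Matrix.unitaryGroup (Fin N → Bool) ℂ) (K : Finset {i // i ∈ I})
    (J : {i // i ∈ I} → Finset (Fin N)) : Prop where
  ordConnected : ∀ i ∈ K, (J i : Set (Fin N)).OrdConnected
  mem : ∀ i ∈ K, i.1 ∈ J i
  disjoint : (K : Set {i // i ∈ I}).PairwiseDisjoint J
  spreadsInto : ∀ i ∈ K, SpreadsInto U {i.1} (J i)

namespace DisjointLightCones

variable {N : ℕ} {I : Finset (Fin N)} {U : Matrix.unitaryGroup (Fin N → Bool) ℂ}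
  {K : Finset {i // i ∈ I}} {J : {i // i ∈ I} → Finset (Fin N)}

theorem lt (h : DisjointLightCones U K J) {i k : {i // i ∈ I}} (hi : i ∈ K) (hk : k ∈ K)
    (hik : i < k) {b c : Fin N} (hb : b ∈ J i) (hc : c ∈ J k) : b < c := by
  have hd := Finset.disjoint_left.1 (h.disjoint hi hk hik.ne)
  by_contra! hcb
  rcases le_or_gt k.1 b with hkb | hbk
  · exact hd ((h.ordConnected i hi).out (h.mem i hi) hb ⟨hik.le, hkb⟩) (h.mem k hk)
  · exact hd hb ((h.ordConnected k hk).out hc (h.mem k hk) ⟨hcb, hbk.le⟩)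

theorem subset_of_between (h : DisjointLightCones U K J) {T : Finset (Fin N)}
    (hT : (T : Set (Fin N)).OrdConnected) {i k j : {i // i ∈ I}} (hi : i ∈ K) (hk : k ∈ K)
    (hj : j ∈ K) (hik : i < k) (hkj : k < j) (hTi : ¬Disjoint T (J i)) (hTj : ¬Disjoint T (J j)) :
    J k ⊆ T := by
  obtain ⟨b, hbT, hb⟩ := Finset.not_disjoint_iff.1 hTi
  obtain ⟨c, hcT, hc⟩ := Finset.not_disjoint_iff.1 hTj
  exact fun x hx => hT.out hbT hcT ⟨(h.lt hi hk hik hb hx).le, (h.lt hk hj hkj hx hc).le⟩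

theorem card_touching_le (h : DisjointLightCones U K J) {T : Finset (Fin N)}
    (hT : (T : Set (Fin N)).OrdConnected) :
    {i ∈ K | ¬Disjoint T (J i)}.card ≤ {i ∈ K | J i ⊆ T}.card + 2 := by
  set R := {i ∈ K | ¬Disjoint T (J i)}
  rcases R.eq_empty_or_nonempty with hR | hR
  · simp [hR]
  have hsub : R ⊆ {i ∈ K | J i ⊆ T} ∪ {R.min' hR, R.max' hR} := by
    intro k hk
    rw [Finset.mem_union, Finset.mem_insert, Finset.mem_singleton, or_iff_not_imp_right, not_or]
    intro hne
    have hkK := (Finset.mem_filter.1 hk).1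
    have hmin := Finset.mem_filter.1 (R.min'_mem hR)
    have hmax := Finset.mem_filter.1 (R.max'_mem hR)
    exact Finset.mem_filter.2 ⟨hkK, h.subset_of_between hT hmin.1 hkK hmax.1
      ((R.min'_le k hk).lt_of_ne' hne.1) ((R.le_max' k hk).lt_of_ne hne.2) hmin.2 hmax.2⟩
  exact (Finset.card_le_card hsub).trans ((Finset.card_union_le _ _).trans
    (Nat.add_le_add_left Finset.card_le_two _))

theorem card_between_le (h : DisjointLightCones U K J) {T : Finset (Fin N)}
    (hT : (T : Set (Fin N)).OrdConnected) {i j : {i // i ∈ I}} (hi : i ∈ K) (hj : j ∈ K)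
    (hTi : ¬Disjoint T (J i)) (hTj : ¬Disjoint T (J j)) :
    {k ∈ K | i ≤ k ∧ k ≤ j}.card ≤ {i ∈ K | ¬Disjoint T (J i)}.card := by
  refine Finset.card_le_card fun k hk => ?_
  obtain ⟨hkK, hik, hkj⟩ := Finset.mem_filter.1 hk
  refine Finset.mem_filter.2 ⟨hkK, ?_⟩
  rcases hik.eq_or_lt with rfl | hik
  · exact hTi
  rcases hkj.eq_or_lt with rfl | hkj
  · exact hTj
  exact Finset.not_disjoint_iff.2
    ⟨k, h.subset_of_between hT hi hkK hj hik hkj hTi hTj (h.mem k hkK), h.mem k hkK⟩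

theorem layer (h : DisjointLightCones U K J) {M : CZLayer N} {m : ℕ}
    (hM : ∀ T ∈ M.gates, {i ∈ K | ¬Disjoint T (J i)}.card ≤ m)
    {K' : Finset {i // i ∈ I}} (hK' : K' ⊆ K)
    (hsparse : ∀ i ∈ K', ∀ j ∈ K', i < j → m < {k ∈ K | i ≤ k ∧ k ≤ j}.card)
    (L : SingleQubitLayer N) :
    DisjointLightCones (L.toUnitary * M.toUnitary * U) K' fun i => M.spread (J i) where
  ordConnected i hi := M.ordConnected_spread ⟨i, h.mem i (hK' hi)⟩ (h.ordConnected i (hK' hi))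
  mem i hi := M.subset_spread _ (h.mem i (hK' hi))
  disjoint := by
    have hdisj (i) (hi : i ∈ K') (j) (hj : j ∈ K') (hij : i < j) :
        Disjoint (M.spread (J i)) (M.spread (J j)) := by
      refine M.disjoint_spread (h.disjoint (hK' hi) (hK' hj) hij.ne) fun T hT => ?_
      by_contra! hT'
      exact ((h.card_between_le (M.interval T hT) (hK' hi) (hK' hj) hT'.1 hT'.2).trans
        (hM T hT)).not_gt (hsparse i hi j hj hij)
    intro i hi j hj hij
    exact hij.lt_or_gt.elim (hdisj i hi j hj) fun hji => (hdisj j hj i hi hji).symm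
  spreadsInto i hi := by
    rw [mul_assoc]
    exact ((h.spreadsInto i (hK' hi)).trans (M.spreadsInto (J i))).trans (L.spreadsInto _)

end DisjointLightCones

/-! ### Deletion of wide gates -/

/-- The basis states on which `czGate T` acts by `-1`. -/
def firingStates {N : ℕ} (T : Finset (Fin N)) : Set (Fin N → Bool) := {y | ∀ i ∈ T, y i = true}

theorem norm_prod_czSign {N : ℕ} (s : Finset (Finset (Fin N))) (y : Fin N → Bool) :
    ‖(∏ T ∈ s, czSign T) y‖ = 1 := by
  rw [Finset.prod_apply, norm_prod]
  refine Finset.prod_eq_one fun T _ => ?_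
  unfold czSign
  split_ifs <;> simp

namespace CZLayer

variable {N : ℕ} (M : CZLayer N) (p : Finset (Fin N) → Prop) [DecidablePred p]

theorem prod_czSign_filter_gates_apply {y : Fin N → Bool}
    (hy : ∀ T ∈ M.gates, ¬p T → y ∉ firingStates T) :
    (∏ T ∈ (M.filter p).gates, czSign T) y = (∏ T ∈ M.gates, czSign T) y := by
  simp only [Finset.prod_apply]
  refine Finset.prod_filter_of_ne fun T hT hTy => ?_
  by_contra hpT
  exact hTy (if_neg (hy T hT hpT))

theorem norm_prod_czSign_sub_prod_filter_sq_le (y : Fin N → Bool) :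
    ‖(∏ T ∈ M.gates, czSign T - ∏ T ∈ (M.filter p).gates, czSign T) y‖ ^ 2 ≤
      ∑ T ∈ M.gates with ¬p T,
        4 * ‖(firingStates T).indicator (1 : (Fin N → Bool) → ℂ) y‖ ^ 2 := by
  by_cases hy : ∀ T ∈ M.gates, ¬p T → y ∉ firingStates T
  · rw [Pi.sub_apply, M.prod_czSign_filter_gates_apply p hy, sub_self, norm_zero,
      zero_pow two_ne_zero]
    positivity
  · push Not at hy
    obtain ⟨T, hT, hpT, hTy⟩ := hy
    calc ‖(∏ T ∈ M.gates, czSign T - ∏ T ∈ (M.filter p).gates, czSign T) y‖ ^ 2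
        ≤ (1 + 1) ^ 2 := by
          gcongr
          exact (norm_sub_le _ _).trans_eq (by rw [norm_prod_czSign, norm_prod_czSign])
      _ = 4 * ‖(firingStates T).indicator (1 : (Fin N → Bool) → ℂ) y‖ ^ 2 := by
          rw [Set.indicator_of_mem hTy, Pi.one_apply, norm_one]
          norm_num
      _ ≤ _ := Finset.single_le_sum (f := fun T : Finset (Fin N) =>
            4 * ‖(firingStates T).indicator (1 : (Fin N → Bool) → ℂ) y‖ ^ 2)
          (fun T _ => by positivity) (Finset.mem_filter.2 ⟨hT, hpT⟩)

open scoped Matrix.Norms.Frobenius in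
theorem norm_sub_filter_mul_sq_le {k : Type*} [Fintype k] (W : Matrix (Fin N → Bool) k ℂ) :
    ‖(M.operator - (M.filter p).operator) * W‖ ^ 2 ≤
      ∑ T ∈ M.gates with ¬p T, 4 * ‖basisProjection (firingStates T) * W‖ ^ 2 := by
  have hdiag : M.operator - (M.filter p).operator =
      Matrix.diagonal (∏ T ∈ M.gates, czSign T - ∏ T ∈ (M.filter p).gates, czSign T) := by
    rw [M.operator_eq_diagonal, (M.filter p).operator_eq_diagonal]
    exact Matrix.diagonal_sub _ _
  calc ‖(M.operator - (M.filter p).operator) * W‖ ^ 2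
      = ∑ y, ‖(∏ T ∈ M.gates, czSign T - ∏ T ∈ (M.filter p).gates, czSign T) y‖ ^ 2 *
          ∑ x, ‖W y x‖ ^ 2 := by rw [hdiag, frobenius_norm_diagonal_mul_sq]
    _ ≤ ∑ y, (∑ T ∈ M.gates with ¬p T,
          4 * ‖(firingStates T).indicator (1 : (Fin N → Bool) → ℂ) y‖ ^ 2) *
            ∑ x, ‖W y x‖ ^ 2 := by
        gcongr with y
        exact M.norm_prod_czSign_sub_prod_filter_sq_le p y
    _ = ∑ T ∈ M.gates with ¬p T, 4 * ‖basisProjection (firingStates T) * W‖ ^ 2 := by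
        simp only [basisProjection, frobenius_norm_diagonal_mul_sq, Finset.mul_sum _ _ (4 : ℝ),
          Finset.sum_mul, mul_assoc]
        exact Finset.sum_comm

end CZLayer

namespace DisjointLightCones

variable {N : ℕ} {I : Finset (Fin N)} {U : Matrix.unitaryGroup (Fin N → Bool) ℂ}
  {K : Finset {i // i ∈ I}} {J : {i // i ∈ I} → Finset (Fin N)} {m : ℕ}

theorem card_wide_gates_mul_le (h : DisjointLightCones U K J) (M : CZLayer N) :
    {T ∈ M.gates | ¬{i ∈ K | ¬Disjoint T (J i)}.card ≤ m}.card * (m - 1) ≤ K.card := by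
  have hcontained : ∀ T ∈ {T ∈ M.gates | ¬{i ∈ K | ¬Disjoint T (J i)}.card ≤ m},
      m - 1 ≤ {i ∈ K | J i ⊆ T}.card := fun T hT => by
    have hT := Finset.mem_filter.1 hT
    have := h.card_touching_le (M.interval T hT.1)
    omega
  refine (Finset.card_nsmul_le_sum _ _ _ hcontained).trans ?_
  rw [← Finset.card_biUnion]
  · exact Finset.card_le_card (Finset.biUnion_subset.2 fun T _ => Finset.filter_subset _ _)
  · intro T hT T' hT' hne
    refine Finset.disjoint_left.2 fun i hi hi' => ?_
    obtain ⟨hiK, hiT⟩ := Finset.mem_filter.1 hi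
    exact Finset.disjoint_left.1
      (M.disjoint (Finset.mem_filter.1 hT).1 (Finset.mem_filter.1 hT').1 hne)
      (hiT (h.mem i hiK)) ((Finset.mem_filter.1 hi').2 (h.mem i hiK))

theorem two_mul_card_wide_gates_le (h : DisjointLightCones U K J) (M : CZLayer N) (hm : 5 ≤ m)
    {K' : Finset {i // i ∈ I}} (hK' : K' ⊆ K) (hcard : m * K'.card < K.card + m) :
    2 * {T ∈ M.gates | ¬{i ∈ K | ¬Disjoint T (J i)}.card ≤ m}.card + K'.card ≤ K.card := by
  rcases Finset.eq_empty_or_nonempty {T ∈ M.gates | ¬{i ∈ K | ¬Disjoint T (J i)}.card ≤ m} with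
    hD | ⟨T, hT⟩
  · rw [hD, Finset.card_empty, mul_zero, zero_add]
    exact Finset.card_le_card hK'
  · have hmK : m < K.card := (not_le.1 (Finset.mem_filter.1 hT).2).trans_le
      (Finset.card_le_card (Finset.filter_subset _ _))
    have hD := h.card_wide_gates_mul_le M (m := m)
    obtain ⟨r, rfl⟩ := Nat.exists_eq_add_of_le hm
    have hr : 5 + r - 1 = 4 + r := by omega
    rw [hr] at hD
    nlinarith

open scoped Matrix.Norms.Frobenius

theorem norm_basisProjection_firingStates_sq_le (h : DisjointLightCones U K J)
    {a : EuclideanSpace ℂ ({j // j ∉ I} → Bool)} (ha : ‖a‖ = 1) {T : Finset (Fin N)}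
    (hT : (T : Set (Fin N)).OrdConnected) (hTm : m < {i ∈ K | ¬Disjoint T (J i)}.card) :
    ‖basisProjection (firingStates T) * (U.1 * inputMatrix a)‖ ^ 2 ≤ 2 * (2 ^ I.card / 2 ^ m) := by
  set B := {i ∈ K | J i ⊆ T}
  have hspread : ∀ i ∈ B, SpreadsInto U {i.1} T := fun i hi A hA =>
    localAlgebra_mono (Finset.coe_subset.2 (Finset.mem_filter.1 hi).2)
      (h.spreadsInto i (Finset.mem_filter.1 hi).1 A hA)
  have hB : Bᶜ.card + m ≤ I.card + 1 := by
    have hcompl : B.card + Bᶜ.card = I.card := by rw [Finset.card_add_card_compl, Fintype.card_coe]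
    have : _ ≤ B.card + 2 := h.card_touching_le hT
    omega
  calc ‖basisProjection (firingStates T) * (U.1 * inputMatrix a)‖ ^ 2
      ≤ 2 ^ Bᶜ.card := norm_basisProjection_mul_inputMatrix_sq_le hspread ha fun _ => true
    _ ≤ 2 * (2 ^ I.card / 2 ^ m) := by
        rw [← mul_div_assoc, le_div_iff₀ (by positivity), ← pow_add, ← pow_succ']
        exact pow_le_pow_right₀ one_le_two hB

theorem exists_layer (h : DisjointLightCones U K J) {a : EuclideanSpace ℂ ({j // j ∉ I} → Bool)}
    (ha : ‖a‖ = 1) (hm : 5 ≤ m) (M : CZLayer N) (L : SingleQubitLayer N) :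
    ∃ (M' : CZLayer N) (K' : Finset {i // i ∈ I}) (J' : {i // i ∈ I} → Finset (Fin N)),
      DisjointLightCones (L.toUnitary * M'.toUnitary * U) K' J' ∧ K' ⊆ K ∧
      K.card ≤ m * K'.card ∧
      ‖(M.operator - M'.operator) * (U.1 * inputMatrix a)‖ ^ 2 ≤
        4 * (2 ^ I.card / 2 ^ m) * (K.card - K'.card) := by
  obtain ⟨K', hK', hcard, hcard', hsparse⟩ := exists_sparse_subset K (m := m) (by omega)
  set D := {T ∈ M.gates | ¬{i ∈ K | ¬Disjoint T (J i)}.card ≤ m}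
  set p : Finset (Fin N) → Prop := fun T => {i ∈ K | ¬Disjoint T (J i)}.card ≤ m
  refine ⟨M.filter p, K', _,
    h.layer (fun T hT => (Finset.mem_filter (p := p).1 hT).2) hK' hsparse L, hK', hcard, ?_⟩
  have hD : 2 * (D.card : ℝ) + K'.card ≤ K.card := by
    exact_mod_cast h.two_mul_card_wide_gates_le M hm hK' hcard'
  calc ‖(M.operator - (M.filter p).operator) * (U.1 * inputMatrix a)‖ ^ 2
      ≤ ∑ T ∈ D, 4 * ‖basisProjection (firingStates T) * (U.1 * inputMatrix a)‖ ^ 2 :=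
        M.norm_sub_filter_mul_sq_le _ _
    _ ≤ ∑ T ∈ D, 4 * (2 * (2 ^ I.card / 2 ^ m)) := by
        gcongr with T hT
        rw [Finset.mem_filter, not_le] at hT
        exact h.norm_basisProjection_firingStates_sq_le ha (M.interval T hT.1) hT.2
    _ = 4 * (2 ^ I.card / 2 ^ m) * (2 * D.card) := by
        rw [Finset.sum_const, nsmul_eq_mul]
        ring
    _ ≤ 4 * (2 ^ I.card / 2 ^ m) * (K.card - K'.card) := by
        gcongr
        linarith

end DisjointLightCones

theorem sqrt_mul_add_sqrt_le {s A B : ℝ} (hs : 0 ≤ s) (hA : 0 ≤ A) (hB : 0 ≤ B) :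
    √(s * A) + √B ≤ √((s + 1) * (A + B)) := by
  refine Real.le_sqrt_of_sq_le ?_
  have hcross : √(s * A) * √B = √(s * B) * √A := by
    rw [← Real.sqrt_mul (by positivity), ← Real.sqrt_mul (by positivity), mul_right_comm]
  have hsA : √(s * A) ^ 2 = s * A := Real.sq_sqrt (by positivity)
  have hsB : √(s * B) ^ 2 = s * B := Real.sq_sqrt (by positivity)
  nlinarith [sq_nonneg (√(s * B) - √A), Real.sq_sqrt hA, Real.sq_sqrt hB]

namespace OneDimQAC

variable {N d : ℕ} {I : Finset (Fin N)}

theorem disjointLightCones_init (L : SingleQubitLayer N) :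
    DisjointLightCones L.toUnitary (Finset.univ : Finset {i // i ∈ I}) fun i => {i.1} where
  ordConnected i _ := by
    rw [Finset.coe_singleton]
    exact Set.ordConnected_singleton
  mem i _ := Finset.mem_singleton_self _
  disjoint i _ j _ hij := Finset.disjoint_singleton.2 fun h => hij (Subtype.ext h)
  spreadsInto i _ := by
    rw [Finset.coe_singleton]
    exact L.spreadsInto _

open scoped Matrix.Norms.Frobenius

theorem norm_layer_operator_sub_mul_le {k : Type*} [Fintype k] (C C' : OneDimQAC N d)
    (M M' : CZLayer N) (L : SingleQubitLayer N) (V : Matrix (Fin N → Bool) k ℂ) :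
    ‖((C.layer M L).operator - (C'.layer M' L).operator) * V‖ ≤
      ‖(C.operator - C'.operator) * V‖ + ‖(M.operator - M'.operator) * (C'.operator * V)‖ := by
  have hsplit : ((C.layer M L).operator - (C'.layer M' L).operator) * V =
      L.operator * (M.operator * ((C.operator - C'.operator) * V) +
        (M.operator - M'.operator) * (C'.operator * V)) := by
    simp only [operator, Matrix.mul_assoc, Matrix.mul_sub, Matrix.sub_mul, Matrix.mul_add]
    abel
  calc ‖((C.layer M L).operator - (C'.layer M' L).operator) * V‖
      = ‖M.operator * ((C.operator - C'.operator) * V) +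
          (M.operator - M'.operator) * (C'.operator * V)‖ := by
        rw [hsplit]
        exact frobenius_norm_unitary_mul L.toUnitary.2 _
    _ ≤ ‖M.operator * ((C.operator - C'.operator) * V)‖ +
          ‖(M.operator - M'.operator) * (C'.operator * V)‖ := norm_add_le _ _
    _ = _ := congrArg (· + _) (frobenius_norm_unitary_mul M.toUnitary.2 _)

theorem exists_disjointLightCones {a : EuclideanSpace ℂ ({j // j ∉ I} → Bool)} (ha : ‖a‖ = 1)
    {m : ℕ} (hm : 5 ≤ m) (C : OneDimQAC N d) :
    ∃ (C' : OneDimQAC N d) (K : Finset {i // i ∈ I}) (J : {i // i ∈ I} → Finset (Fin N)),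
      DisjointLightCones C'.toUnitary K J ∧ I.card ≤ m ^ d * K.card ∧
      ‖(C.operator - C'.operator) * inputMatrix a‖ ≤
        √(d * (4 * (2 ^ I.card / 2 ^ m) * (I.card - K.card))) := by
  induction C with
  | init L => exact ⟨.init L, Finset.univ, _, disjointLightCones_init L, by simp, by simp⟩
  | @layer d C M L ih =>
    obtain ⟨C', K, J, hJ, hK, hnorm⟩ := ih
    obtain ⟨M', K', J', hJ', hKK', hcard, hnorm'⟩ := hJ.exists_layer ha hm M L
    refine ⟨.layer C' M' L, K', J', hJ', ?_, ?_⟩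
    · rw [pow_succ, mul_assoc]
      exact hK.trans (Nat.mul_le_mul_left _ hcard)
    have hKI : (K.card : ℝ) ≤ I.card := by
      exact_mod_cast (Finset.card_le_univ K).trans_eq (Fintype.card_coe I)
    have hKK : (K'.card : ℝ) ≤ K.card := by exact_mod_cast Finset.card_le_card hKK'
    set δ : ℝ := 4 * (2 ^ I.card / 2 ^ m)
    have hδ : 0 ≤ δ := by positivity
    calc ‖((C.layer M L).operator - (C'.layer M' L).operator) * inputMatrix a‖
        ≤ ‖(C.operator - C'.operator) * inputMatrix a‖ +
            ‖(M.operator - M'.operator) * (C'.operator * inputMatrix a)‖ :=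
          norm_layer_operator_sub_mul_le _ _ _ _ _ _
      _ ≤ √(d * (δ * (I.card - K.card))) + √(δ * (K.card - K'.card)) := by
          rw [C'.coe_toUnitary] at hnorm'
          exact add_le_add hnorm (Real.le_sqrt_of_sq_le hnorm')
      _ ≤ √((d + 1) * (δ * (I.card - K.card) + δ * (K.card - K'.card))) :=
          sqrt_mul_add_sqrt_le d.cast_nonneg (mul_nonneg hδ (sub_nonneg.2 hKI))
            (mul_nonneg hδ (sub_nonneg.2 hKK))
      _ = √((d + 1 : ℕ) * (δ * (I.card - K'.card))) := by
          rw [← mul_add, sub_add_sub_cancel, Nat.cast_succ]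

end OneDimQAC

/-! ### Acceptance probabilities -/

theorem abs_norm_sq_sub_norm_sq_le {E : Type*} [SeminormedAddCommGroup E] {u v : E}
    (hu : ‖u‖ ≤ 1) (hv : ‖v‖ ≤ 1) : |‖u‖ ^ 2 - ‖v‖ ^ 2| ≤ 2 * ‖u - v‖ :=
  calc |‖u‖ ^ 2 - ‖v‖ ^ 2| = |‖u‖ + ‖v‖| * |‖u‖ - ‖v‖| := by rw [sq_sub_sq, abs_mul]
    _ ≤ 2 * ‖u - v‖ := by
      rw [abs_of_nonneg (by positivity)]
      gcongr
      · linarith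
      · exact abs_norm_sub_norm_le u v

theorem cubeNorm_le_one {ι : Type*} [Fintype ι] [DecidableEq ι] {f : (ι → Bool) → ℝ}
    (hf : ∀ x, |f x| ≤ 1) : cubeNorm f ≤ 1 := by
  rw [cubeNorm, Real.sqrt_le_one, div_le_one (by positivity)]
  calc ∑ x, f x ^ 2 ≤ ∑ _x : ι → Bool, 1 := by
        gcongr with x
        exact (sq_le_one_iff_abs_le_one _).2 (hf x)
    _ = 2 ^ Fintype.card ι := by simp

theorem norm_toLp_diagonal_mulVec_of_spreadsInto {ι κ : Type*} [Fintype ι] [DecidableEq ι]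
    [Fintype κ] [DecidableEq κ] {U S : Matrix.unitaryGroup (ι → κ) ℂ} {J J' : Set ι}
    (hU : SpreadsInto U J J') (hS : S.1 ∈ localAlgebra J) {f : (ι → κ) → ℂ}
    (hf : DependsOn f J'ᶜ) (v : (ι → κ) → ℂ) :
    ‖WithLp.toLp 2 (Matrix.diagonal f *ᵥ (U.1 *ᵥ (S.1 *ᵥ v)))‖ =
      ‖WithLp.toLp 2 (Matrix.diagonal f *ᵥ (U.1 *ᵥ v))‖ := by
  have hconj : Matrix.diagonal f * (U.1 * S.1) = (U * S * star U).1 * (Matrix.diagonal f * U.1) :=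
    calc Matrix.diagonal f * (U.1 * S.1)
        = Matrix.diagonal f * (U * S * star U).1 * U.1 := by
          simp [mul_assoc]
      _ = (U * S * star U).1 * (Matrix.diagonal f * U.1) := by
          rw [← mul_assoc]
          exact congrArg (· * U.1) (commute_diagonal_of_mem_localAlgebra (hU S.1 hS) hf).eq.symm
  calc ‖WithLp.toLp 2 (Matrix.diagonal f *ᵥ (U.1 *ᵥ (S.1 *ᵥ v)))‖
      = ‖WithLp.toLp 2 ((U * S * star U).1 *ᵥ (Matrix.diagonal f *ᵥ (U.1 *ᵥ v)))‖ := by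
        simp only [Matrix.mulVec_mulVec, hconj]
    _ = _ := norm_toLp_mulVec_of_mem_unitaryGroup (U * S * star U).2 _

theorem siteOp_mem_unitaryGroup {N : ℕ} (j : Fin N) {E : Matrix Bool Bool ℂ}
    (hE : E ∈ Matrix.unitaryGroup Bool ℂ) :
    siteOp j E ∈ Matrix.unitaryGroup (Fin N → Bool) ℂ := by
  have h : siteOp j E = SingleQubitLayer.operator (Pi.mulSingle j ⟨E, hE⟩) := by
    rw [← tensorOperator_mulSingle, SingleQubitLayer.operator]
    congr 1
    funext i
    exact (Pi.apply_mulSingle (fun _ (V : Matrix.unitaryGroup Bool ℂ) => V.1) (fun _ => rfl) j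
      ⟨E, hE⟩ i).symm
  rw [h]
  exact (SingleQubitLayer.toUnitary _).2

theorem permMatrix_mem_unitaryGroup {n : Type*} [Fintype n] [DecidableEq n] (σ : Equiv.Perm n) :
    σ.permMatrix ℂ ∈ Matrix.unitaryGroup n ℂ := by
  rw [Matrix.mem_unitaryGroup_iff, Matrix.star_eq_conjTranspose, Matrix.conjTranspose_permMatrix,
    ← Matrix.permMatrix_mul, inv_mul_cancel, Matrix.permMatrix_one]

theorem siteOp_permMatrix_mulVec_initialState {N : ℕ} {I : Finset (Fin N)}
    (a : EuclideanSpace ℂ ({j // j ∉ I} → Bool)) (j : {i // i ∈ I}) (b : Bool)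
    (x : {i // i ∈ I} → Bool) :
    siteOp j.1 ((Equiv.swap (x j) b).permMatrix ℂ) *ᵥ initialState a x =
      initialState a (Function.update x j b) := by
  funext y
  rw [siteOp_mulVec_apply, Finset.sum_eq_single (Equiv.swap (x j) b (y j))]
  · have hiff : (∀ i : {i // i ∈ I}, Function.update y j.1 (Equiv.swap (x j) b (y j)) i = x i) ↔
        ∀ i : {i // i ∈ I}, y i = Function.update x j b i := by
      refine forall_congr' fun i => ?_
      rcases eq_or_ne i j with rfl | hij
      · rw [Function.update_self, Function.update_self, Equiv.swap_apply_eq_iff,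
          Equiv.swap_apply_left]
      · rw [Function.update_of_ne hij, Function.update_of_ne (Subtype.coe_ne_coe.2 hij)]
    have hanc (i : {i // i ∉ I}) : Function.update y j.1 (Equiv.swap (x j) b (y j)) i = y i :=
      Function.update_of_ne (ne_of_mem_of_not_mem j.2 i.2).symm _ _
    simp only [initialState, hiff, hanc]
    simp [PEquiv.toMatrix_apply]
  · intro c _ hc
    simp [PEquiv.toMatrix_apply, hc.symm]
  · simp

namespace OneDimQAC

variable {N d : ℕ} {I : Finset (Fin N)} {a : EuclideanSpace ℂ ({j // j ∉ I} → Bool)}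

theorem acceptProb_eq_norm_sq (C : OneDimQAC N d) (a : EuclideanSpace ℂ ({j // j ∉ I} → Bool))
    (q : Fin N) (x : {i // i ∈ I} → Bool) :
    C.acceptProb a q x = ‖WithLp.toLp 2
      (basisProjection {y | y q = true} *ᵥ (C.operator *ᵥ initialState a x))‖ ^ 2 := by
  rw [EuclideanSpace.norm_sq_eq, acceptProb, Finset.sum_filter]
  refine Finset.sum_congr rfl fun y _ => ?_
  rw [PiLp.toLp_apply, basisProjection_mulVec, Set.indicator_apply]
  split_ifs <;> simp_all

theorem norm_toLp_operator_mulVec_initialState (C : OneDimQAC N d) (ha : ‖a‖ = 1)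
    (x : {i // i ∈ I} → Bool) : ‖WithLp.toLp 2 (C.operator *ᵥ initialState a x)‖ = 1 := by
  rw [← C.coe_toUnitary, norm_toLp_mulVec_of_mem_unitaryGroup C.toUnitary.2,
    norm_toLp_initialState, ha]

theorem acceptProb_mem_Icc (C : OneDimQAC N d) (ha : ‖a‖ = 1) (q : Fin N)
    (x : {i // i ∈ I} → Bool) : C.acceptProb a q x ∈ Set.Icc (0 : ℝ) 1 := by
  rw [acceptProb_eq_norm_sq]
  exact ⟨sq_nonneg _, pow_le_one₀ (norm_nonneg _) ((norm_toLp_basisProjection_mulVec_le _ _).trans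
    (C.norm_toLp_operator_mulVec_initialState ha x).le)⟩

theorem abs_acceptProb_sub_le (C C' : OneDimQAC N d) (ha : ‖a‖ = 1) (q : Fin N)
    (x : {i // i ∈ I} → Bool) :
    |C'.acceptProb a q x - C.acceptProb a q x| ≤
      2 * ‖WithLp.toLp 2 ((C.operator - C'.operator) *ᵥ initialState a x)‖ := by
  have hle (D : OneDimQAC N d) : ‖WithLp.toLp 2
      (basisProjection {y | y q = true} *ᵥ (D.operator *ᵥ initialState a x))‖ ≤ 1 :=
    (norm_toLp_basisProjection_mulVec_le _ _).trans
      (D.norm_toLp_operator_mulVec_initialState ha x).le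
  rw [abs_sub_comm, acceptProb_eq_norm_sq, acceptProb_eq_norm_sq]
  refine (abs_norm_sq_sub_norm_sq_le (hle C) (hle C')).trans ?_
  rw [← WithLp.toLp_sub, ← Matrix.mulVec_sub, ← Matrix.sub_mulVec]
  gcongr
  exact norm_toLp_basisProjection_mulVec_le _ _

open scoped Matrix.Norms.Frobenius in
theorem cubeNorm_acceptProb_sub_le (C C' : OneDimQAC N d) (ha : ‖a‖ = 1) (q : Fin N) :
    cubeNorm (fun x => C'.acceptProb a q x - C.acceptProb a q x) ≤
      2 * ‖(C.operator - C'.operator) * inputMatrix a‖ / √(2 ^ I.card) := by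
  rw [cubeNorm, Real.sqrt_div' _ (by positivity), Fintype.card_coe]
  gcongr
  refine Real.sqrt_le_iff.2 ⟨by positivity, ?_⟩
  calc ∑ x, (C'.acceptProb a q x - C.acceptProb a q x) ^ 2
      ≤ ∑ x, (2 * ‖WithLp.toLp 2 ((C.operator - C'.operator) *ᵥ initialState a x)‖) ^ 2 :=
        Finset.sum_le_sum fun x _ => sq_le_sq.2
          ((C.abs_acceptProb_sub_le C' ha q x).trans (le_abs_self _))
    _ = (2 * ‖(C.operator - C'.operator) * inputMatrix a‖) ^ 2 := by
        simp only [mul_pow, ← Finset.mul_sum, frobenius_norm_sq_eq_sum_col]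
        rfl

theorem dependsOn_acceptProb {C : OneDimQAC N d} {K : Finset {i // i ∈ I}}
    {J : {i // i ∈ I} → Finset (Fin N)} (h : DisjointLightCones C.toUnitary K J)
    (a : EuclideanSpace ℂ ({j // j ∉ I} → Bool)) (q : Fin N) :
    DependsOn (C.acceptProb a q) {i | i ∈ K → q ∈ J i} := by
  refine dependsOn_of_update fun j hj x b => ?_
  obtain ⟨hjK, hqj⟩ := Classical.not_imp.1 hj
  have hq : DependsOn ({y : Fin N → Bool | y q = true}.indicator (1 : (Fin N → Bool) → ℂ))
      (J j : Set (Fin N))ᶜ := fun y z hyz => by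
    simp [Set.indicator_apply, hyz q hqj]
  rw [acceptProb_eq_norm_sq, acceptProb_eq_norm_sq, ← siteOp_permMatrix_mulVec_initialState,
    ← C.coe_toUnitary]
  exact congrArg (· ^ 2) (norm_toLp_diagonal_mulVec_of_spreadsInto
    (S := ⟨_, siteOp_mem_unitaryGroup _ (permMatrix_mem_unitaryGroup _)⟩)
    (h.spreadsInto j hjK) (siteOp_mem_localAlgebra _ _) hq _)

theorem exists_restrict_acceptProb_eq {C : OneDimQAC N d} {K : Finset {i // i ∈ I}}
    {J : {i // i ∈ I} → Finset (Fin N)} (h : DisjointLightCones C.toUnitary K J)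
    (hK : K.Nonempty) (ha : ‖a‖ = 1) (q : Fin N) (z : {i // i ∈ Kᶜ} → Bool) :
    ∃ (i : {i // i ∉ Kᶜ}) (g : Bool → ℝ), (∀ b, g b ∈ Set.Icc (0 : ℝ) 1) ∧
      ∀ y : {i // i ∉ Kᶜ} → Bool, restrict (C.acceptProb a q) Kᶜ z y = g (y i) := by
  obtain ⟨i, hi, hiq⟩ : ∃ i ∈ K, ∀ j ∈ K, q ∈ J j → j = i := by
    by_cases hq : ∃ i ∈ K, q ∈ J i
    · obtain ⟨i, hi, hqi⟩ := hq
      exact ⟨i, hi, fun j hj hqj => h.disjoint.elim_finset hj hi q hqj hqi⟩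
    · push Not at hq
      obtain ⟨i, hi⟩ := hK
      exact ⟨i, hi, fun j hj hqj => absurd hqj (hq j hj)⟩
  refine ⟨⟨i, by simpa using hi⟩, fun b => restrict (C.acceptProb a q) Kᶜ z fun _ => b,
    fun b => C.acceptProb_mem_Icc ha q _, fun y => dependsOn_acceptProb h a q fun j hj => ?_⟩
  by_cases hjK : j ∈ Kᶜ
  · simp only [dif_pos hjK]
  · obtain rfl := hiq j (by simpa using hjK) (hj (by simpa using hjK))
    simp only [dif_neg hjK]

end OneDimQAC

theorem le_two_pow_floor_logb_div_mul {x ε : ℝ} (hx : 0 < x) (hε : 0 < ε) :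
    x ≤ 2 ^ (⌊Real.logb 2 (x / ε)⌋₊ + 1) * ε := by
  rw [← div_le_iff₀ hε, ← Real.rpow_natCast, ← Real.logb_le_iff_le_rpow one_lt_two (by positivity),
    Nat.cast_succ]
  exact (Nat.lt_floor_add_one _).le

theorem one_le_four_mul_sqrt {d n m : ℕ} {ε : ℝ} (hd : 1 ≤ d) (hn : 1 ≤ n) (hε : 0 ≤ ε)
    (hm : m < 5) (h : n ≤ 2 ^ (m + 1) * ε) : 1 ≤ 4 * √(2 * d * ε) := by
  have hdε : 1 ≤ 32 * (d * ε) :=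
    calc (1 : ℝ) ≤ n := by exact_mod_cast hn
      _ ≤ 2 ^ (m + 1) * ε := h
      _ ≤ 2 ^ 5 * (d * ε) := by
        gcongr
        · exact one_le_two
        · exact hm
        · exact le_mul_of_one_le_left hε (by exact_mod_cast hd)
      _ = 32 * (d * ε) := by norm_num
  have hsqrt : 1 / 4 ≤ √(2 * d * ε) := Real.le_sqrt_of_sq_le (by linarith)
  linarith

theorem two_mul_sqrt_div_sqrt_two_pow_le {d n k m : ℕ} {ε : ℝ} (h : n ≤ 2 ^ (m + 1) * ε) :
    2 * √(d * (4 * (2 ^ n / 2 ^ m) * (n - k))) / √(2 ^ n) ≤ 4 * √(2 * d * ε) := by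
  have hn : ((n : ℝ) - k) / 2 ^ m ≤ 2 * ε := by
    rw [div_le_iff₀ (by positivity)]
    calc (n : ℝ) - k ≤ n := sub_le_self _ k.cast_nonneg
      _ ≤ 2 * ε * 2 ^ m := h.trans_eq (by ring)
  calc 2 * √(d * (4 * (2 ^ n / 2 ^ m) * (n - k))) / √(2 ^ n)
      = 2 * √(4 * d * ((n - k) / 2 ^ m)) := by
        rw [mul_div_assoc, ← Real.sqrt_div' _ (by positivity)]
        congr 2
        field_simp
    _ ≤ 2 * √(2 ^ 2 * (2 * d * ε)) := by
        gcongr 2 * √?_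
        calc 4 * (d : ℝ) * ((n - k) / 2 ^ m) ≤ 4 * d * (2 * ε) := by gcongr
          _ = 2 ^ 2 * (2 * d * ε) := by ring
    _ = 4 * √(2 * d * ε) := by
        rw [Real.sqrt_mul (by norm_num), Real.sqrt_sq (by norm_num)]
        ring

theorem OneDimQAC.cubeNorm_zero_sub_acceptProb_le_one {N d : ℕ} {I : Finset (Fin N)}
    {a : EuclideanSpace ℂ ({j // j ∉ I} → Bool)} (C : OneDimQAC N d) (ha : ‖a‖ = 1) (q : Fin N) :
    cubeNorm (fun x => 0 - C.acceptProb a q x) ≤ 1 := by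
  refine cubeNorm_le_one fun x => ?_
  obtain ⟨h0, h1⟩ := C.acceptProb_mem_Icc ha q x
  rwa [zero_sub, abs_neg, abs_of_nonneg h0]

theorem mainTheorem7 (n d N : ℕ) (hn : 1 ≤ n) (hd : 1 ≤ d) (ε : ℝ) (hε0 : 0 < ε) (hε1 : ε < 1)
    (hlog : 1 ≤ Real.logb 2 (n / ε))
    (C : OneDimQAC N d) (I : Finset (Fin N)) (hI : I.card = n)
    (a : EuclideanSpace ℂ ({j // j ∉ I} → Bool)) (ha : ‖a‖ = 1) (q : Fin N) :
    ∃ (S : Finset {i // i ∈ I}) (f : ({i // i ∈ I} → Bool) → ℝ),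
      (n : ℝ) / Real.logb 2 (n / ε) ^ d ≤ (Sᶜ.card : ℝ) ∧
      (∀ x, f x ∈ Set.Icc (0 : ℝ) 1) ∧
      cubeNorm (fun x => f x - C.acceptProb a q x) ≤ 4 * Real.sqrt (2 * d * ε) ∧
      ∀ z : {i // i ∈ S} → Bool, ∃ (i : {i // i ∉ S}) (g : Bool → ℝ),
        (∀ b, g b ∈ Set.Icc (0 : ℝ) 1) ∧
        ∀ y : {i // i ∉ S} → Bool, restrict f S z y = g (y i) := by
  subst hI
  set m := ⌊Real.logb 2 (I.card / ε)⌋₊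
  have hcard : (I.card : ℝ) ≤ 2 ^ (m + 1) * ε :=
    le_two_pow_floor_logb_div_mul (Nat.cast_pos.2 hn) hε0
  rcases lt_or_ge m 5 with hm | hm
  · obtain ⟨i, hi⟩ : I.Nonempty := Finset.card_pos.1 hn
    refine ⟨∅, fun _ => 0, ?_, by simp, ?_, fun z => ⟨⟨⟨i, hi⟩, by simp⟩, 0, by simp, fun y => rfl⟩⟩
    · simpa using div_le_self (Nat.cast_nonneg (α := ℝ) I.card) (one_le_pow₀ hlog)
    · exact (C.cubeNorm_zero_sub_acceptProb_le_one ha q).trans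
        (one_le_four_mul_sqrt hd hn hε0.le hm hcard)
  · obtain ⟨C', K, J, hJ, hK, hnorm⟩ := C.exists_disjointLightCones ha hm
    have hK0 : K.Nonempty := Finset.card_pos.1 (Nat.pos_of_mul_pos_left (hn.trans hK))
    refine ⟨Kᶜ, C'.acceptProb a q, ?_, C'.acceptProb_mem_Icc ha q, ?_,
      C'.exists_restrict_acceptProb_eq hJ hK0 ha q⟩
    · rw [compl_compl, div_le_iff₀' (by positivity)]
      calc (I.card : ℝ) ≤ m ^ d * K.card := by exact_mod_cast hK
        _ ≤ Real.logb 2 (I.card / ε) ^ d * K.card := by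
          gcongr
          exact Nat.floor_le (zero_le_one.trans hlog)
    · calc _ ≤ _ := C.cubeNorm_acceptProb_sub_le C' ha q
        _ ≤ 2 * √(d * (4 * (2 ^ I.card / 2 ^ m) * (I.card - K.card))) / √(2 ^ I.card) := by gcongr
        _ ≤ 4 * √(2 * d * ε) := two_mul_sqrt_div_sqrt_two_pow_le hcard
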